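/- Let $x=(x_u)_{u\in V}$ be a vector of nonnegative reals indexed by a finite set $V$, with $\gamma=\sum_{u\in V}x_u>0$, and let $\pi=x/\gamma$, a probability distribution on $V$ with Euclidean norm $\|\pi\|$. Given $\epsilon,\delta\in(0,1)$, the algorithm SumApprox$(\epsilon,\delta)$ has access to i.i.d. samples $(u,x_u)$ with $u$ distributed according to $\pi$, and works as follows. It starts with $S=\emptyset$ and $w_S=w=r=0$, and puts $k=\lceil\frac{2+4.4\epsilon}{\epsilon^2}\ln\frac3\delta\rceil$. While $r<k$, it adds $w_S$ to $w$, draws a new sample $(u,x_u)$, and, if $u\in S$, adds $1$ to $r$, and otherwise adds $u$ to $S$ and $x_u$ to $w_S$. When $r=k$ it returns $\hat\gamma=w/r$. For all such $V,x$ and all $\epsilon,\delta\in(0,1)$: (1) with probability at least $1-\frac{2\delta}3$, SumApprox$(\epsilon,\delta)$ halts and returns $\hat\gamma$ with $|\hat\gamma-\gamma|<\epsilon\gamma$; (2) with probability at least $1-\frac\delta3$, SumApprox$(\epsilon,\delta)$ halts after drawing at most $\lceil 45\,\|\pi\|^{-1}\epsilon^{-3}(\ln\frac3\delta)^{3/2}\rceil$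 samples; (3) hence, with probability at least $1-\delta$, SumApprox$(\epsilon,\delta)$ returns $\hat\gamma$ with $(1-\epsilon)\gamma\le\hat\gamma\le(1+\epsilon)\gamma$ and draws at most $\lceil 45\,\|\pi\|^{-1}\epsilon^{-3}(\ln\frac3\delta)^{3/2}\rceil$ samples; (4) this number of samples is $O\big(\|\pi\|^{-1}\epsilon^{-3}(\ln\frac1\delta)^{3/2}\big)$ for $\delta$ bounded away from $1$: for every $\delta_0\in(0,1)$ there is a constant $C>0$, depending only on $\delta_0$, such that whenever $\delta\le\delta_0$, with probability at least $1-\delta$, SumApprox$(\epsilon,\delta)$ returns $\hat\gamma$ with $(1-\epsilon)\gamma\le\hat\gamma\le(1+\epsilon)\gamma$ and draws at most $C\,\|\pi\|^{-1}\epsilon^{-3}(\ln\frac1\delta)^{3/2}$ samples. -/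

import Mathlib

open MeasureTheory ProbabilityTheory

namespace SumApprox

/-- The variables of the algorithm: `S` is the set of distinct elements drawn so far, `wS` the
sum of their values, `w` the cumulative sum of `wS`, and `r` the number of repeats so far. -/
@[ext]
structure State (V : Type*) where
  S : Finset V
  wS : ℝ
  w : ℝ
  r : ℕ

/-- The values of the variables before the while loop. -/
def State.init {V : Type*} : State V := ⟨∅, 0, 0, 0⟩

/-- One execution of the body of the while loop, with the drawn pair `p = (u, γ_u)`. -/
def State.body {V : Type*} [DecidableEq V] (σ : State V) (p : V × ℝ) : State V :=
  if p.1 ∈ σ.S then ⟨σ.S, σ.wS, σ.w + σ.wS, σ.r + 1⟩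
  else ⟨insert p.1 σ.S, σ.wS + p.2, σ.w + σ.wS, σ.r⟩

/-- The variables after `m` executions of the loop body, which consume the first `m` samples. -/
def stateAfter {V : Type*} [DecidableEq V] (samples : ℕ → V × ℝ) : ℕ → State V
  | 0 => State.init
  | m + 1 => (stateAfter samples m).body (samples m)

/-- The halting threshold `⌈(2 + 4.4 ε) / ε² * ln (3 / δ)⌉` on the number of repeats. -/
noncomputable def threshold (ε δ : ℝ) : ℕ :=
  ⌈(2 + 4.4 * ε) / ε ^ 2 * Real.log (3 / δ)⌉₊

/-- `Returns ε δ samples est m`: on the stream `samples` of pairs `(u, γ_u)`, the algorithm with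
parameters `ε, δ` halts after drawing exactly `m` samples and returns the value `est = w / r`.
The loop is executed as long as `r < threshold ε δ`. -/
def Returns {V : Type*} [DecidableEq V] (ε δ : ℝ) (samples : ℕ → V × ℝ) (est : ℝ) (m : ℕ) :
    Prop :=
  (∀ i < m, (stateAfter samples i).r < threshold ε δ) ∧
  threshold ε δ ≤ (stateAfter samples m).r ∧
  est = (stateAfter samples m).w / (stateAfter samples m).r

/-- The probability vector `π = x / γ`, where `γ = ∑ u, x u`, as a vector of Euclidean space. -/
noncomputable def prob {V : Type*} [Fintype V] (x : V → ℝ) : EuclideanSpace ℝ V :=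
  WithLp.toLp 2 fun u => x u / ∑ v, x v

/-- The random elements `X 0, X 1, …` of `V` are i.i.d. with distribution `π = x / γ`. -/
structure IsSampling {V : Type*} [Fintype V] [MeasurableSpace V] {Ω : Type*} [MeasurableSpace Ω]
    (μ : Measure Ω) (X : ℕ → Ω → V) (x : V → ℝ) : Prop where
  measurable : ∀ i, Measurable (X i)
  indep : iIndepFun X μ
  law : ∀ i u, μ (X i ⁻¹' {u}) = ENNReal.ofReal (prob x u)

/-- The explicit bound `⌈45 ‖π‖⁻¹ ε⁻³ (ln (3 / δ))^(3/2)⌉` on the number of samples, where `‖·‖`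
is the Euclidean norm. -/
noncomputable def sampleBound {V : Type*} [Fintype V] (x : V → ℝ) (ε δ : ℝ) : ℕ :=
  ⌈45 * ‖prob x‖⁻¹ * (ε ^ 3)⁻¹ * Real.log (3 / δ) ^ (3 / 2 : ℝ)⌉₊

end SumApprox

/-! Let `p = wS / γ` be the current probability of a repeat. One step raises `w / γ` by exactly `p`
and `r` by a Bernoulli(`p`) variable, so `w / γ - r` is a martingale. Since `1 - (1 - a) p ≤ exp
(-(1 - a) p)`, its exponential version `exp ((1 - a) w / γ) * a ^ r` is a supermartingale for every
`a > 0` (`sum_prob_mul_weightPotential_le`). Freezing the process once `r = k` and applying Markov's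
inequality with `a = (1 ± ε)⁻¹` bounds each tail of the estimate by `δ / 3` (`abs_estimate_sub_lt`).

For the number of samples, put `q = ‖π‖ / 2`. While `p < q`, the increment of `p / q`, capped at 1,
has mean at least `q` (`le_sum_prob_mul_gain`); once `p ≥ q`, a repeat has probability at least `q`.
So `r + min 2 (p / q)` drifts upwards at rate at least `q`, and the mean of its negative exponential
shrinks by `exp (-q / 2)` per step (`sum_prob_mul_repeatPotential_le`). Hence order `‖π‖⁻¹ ε⁻² ln (3
/ δ)` samples suffice, which the stated bound dominates. A union bound over the three bad events
finishes the proof. -/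

namespace SumApprox

/-- The trajectory of the deterministic recursion with transition map `step`, driven by the
inputs `y`. -/
def chain {V σ : Type*} (step : σ → V → σ) (s₀ : σ) (y : ℕ → V) : ℕ → σ
  | 0 => s₀
  | m + 1 => step (chain step s₀ y m) (y m)

lemma chain_invariant {V σ : Type*} {step : σ → V → σ} {s₀ : σ} {P : σ → Prop} (h₀ : P s₀)
    (h : ∀ s u, P s → P (step s u)) (y : ℕ → V) (m : ℕ) : P (chain step s₀ y m) := by
  induction m with
  | zero => exact h₀
  | succ m ih => exact h _ _ ih

/-- For finite `V` this makes every function of the chain integrable, with no structure on `σ`, and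
independent of sample `m`. -/
lemma exists_chain_eq {V σ : Type*} (step : σ → V → σ) (s₀ : σ) (m : ℕ) :
    ∃ g : (Finset.range m → V) → σ, ∀ y : ℕ → V, chain step s₀ y m = g fun i => y i := by
  induction m with
  | zero => exact ⟨fun _ => s₀, fun _ => rfl⟩
  | succ m ih =>
    obtain ⟨g, hg⟩ := ih
    refine ⟨fun v => step (g fun i => v ⟨i, ?_⟩) (v ⟨m, by simp⟩), fun y => ?_⟩
    · have := i.2
      simp only [Finset.mem_range] at this ⊢
      omega
    · simp [chain, hg]

lemma prob_nonneg {V : Type*} [Fintype V] {x : V → ℝ} (hx : ∀ u, 0 ≤ x u) (u : V) : 0 ≤ prob x u :=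
  div_nonneg (hx u) (Finset.sum_nonneg fun v _ => hx v)

lemma sum_prob {V : Type*} [Fintype V] {x : V → ℝ} (hγ : 0 < ∑ u, x u) : ∑ u, prob x u = 1 := by
  simp only [prob, ← Finset.sum_div]
  exact div_self hγ.ne'

/-! ### Expectations and Markov's inequality along a chain driven by i.i.d. samples -/

section Sampling

variable {V : Type*} [Fintype V] [MeasurableSpace V] [DiscreteMeasurableSpace V]
  {Ω : Type*} [MeasurableSpace Ω] {μ : Measure Ω} [IsProbabilityMeasure μ]
  {X : ℕ → Ω → V} {x : V → ℝ} {σ : Type*}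

lemma integrable_comp_chain (hX : IsSampling μ X x) (step : σ → V → σ) (s₀ : σ) (F : σ → ℝ)
    (m : ℕ) : Integrable (fun ω => F (chain step s₀ (X · ω) m)) μ := by
  obtain ⟨g, hg⟩ := exists_chain_eq step s₀ m
  simp only [hg]
  have hmeas : Measurable fun ω => fun i : Finset.range m => X i ω :=
    measurable_pi_lambda _ fun i => hX.measurable i
  exact (Integrable.of_finite (μ := μ.map _) (f := fun v => F (g v))).comp_measurable hmeas

lemma integral_comp_chain_succ (hX : IsSampling μ X x) (hx : ∀ u, 0 ≤ x u)
    (step : σ → V → σ) (s₀ : σ) (F : σ → ℝ) (m : ℕ) :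
    ∫ ω, F (chain step s₀ (X · ω) (m + 1)) ∂μ =
      ∫ ω, ∑ u, prob x u * F (step (chain step s₀ (X · ω) m) u) ∂μ := by
  classical
  -- Splitting over the value of sample `m` gives products of independent factors, in place of a
  -- conditional expectation.
  have hdecomp : ∀ ω, F (chain step s₀ (X · ω) (m + 1)) =
      ∑ u, (if X m ω = u then (1 : ℝ) else 0) * F (step (chain step s₀ (X · ω) m) u) := by
    intro ω
    simp [chain]
  have hint : ∀ u, Integrable (fun ω => F (step (chain step s₀ (X · ω) m) u)) μ := fun u =>
    integrable_comp_chain hX step s₀ (fun s => F (step s u)) m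
  have hmul : ∀ u, Integrable (fun ω => (if X m ω = u then (1 : ℝ) else 0) *
      F (step (chain step s₀ (X · ω) m) u)) μ ∧
      ∫ ω, (if X m ω = u then (1 : ℝ) else 0) * F (step (chain step s₀ (X · ω) m) u) ∂μ =
        prob x u * ∫ ω, F (step (chain step s₀ (X · ω) m) u) ∂μ := by
    intro u
    obtain ⟨g, hg⟩ := exists_chain_eq step s₀ m
    have hind : IndepFun (fun ω => if X m ω = u then (1 : ℝ) else 0)
        (fun ω => F (step (chain step s₀ (X · ω) m) u)) μ := by
      have h := hX.indep.indepFun_finset {m} (Finset.range m) (by simp) hX.measurable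
      simp only [hg]
      exact h.comp (φ := fun v => if v ⟨m, by simp⟩ = u then (1 : ℝ) else 0)
        (ψ := fun v => F (step (g v) u)) (Measurable.of_discrete) (Measurable.of_discrete)
    have hI : Integrable (fun ω => if X m ω = u then (1 : ℝ) else 0) μ :=
      (Integrable.of_finite (μ := μ.map (X m))
        (f := fun v => if v = u then (1 : ℝ) else 0)).comp_measurable (hX.measurable m)
    refine ⟨hind.integrable_mul hI (hint u), ?_⟩
    rw [hind.integral_fun_mul_eq_mul_integral hI.aestronglyMeasurable
      (hint u).aestronglyMeasurable]
    congr 1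
    have : (fun ω => if X m ω = u then (1 : ℝ) else 0) = (X m ⁻¹' {u}).indicator 1 := by
      ext ω
      simp [Set.indicator_apply]
    rw [this, integral_indicator_one (hX.measurable m (measurableSet_singleton u)),
      measureReal_def, hX.law, ENNReal.toReal_ofReal (prob_nonneg hx u)]
  simp only [hdecomp]
  rw [integral_finsetSum _ fun u _ => (hmul u).1,
    integral_finsetSum _ fun u _ => (hint u).const_mul _]
  exact Finset.sum_congr rfl fun u _ => by rw [(hmul u).2, integral_const_mul]

/-- If the potential `F` shrinks by a factor `ρ` on average in every step, then so does its
expectation along the chain. -/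
lemma integral_comp_chain_le (hX : IsSampling μ X x) (hx : ∀ u, 0 ≤ x u)
    {step : σ → V → σ} {s₀ : σ} {P : σ → Prop} (h₀ : P s₀) (hP : ∀ s u, P s → P (step s u))
    {F : σ → ℝ} {ρ : ℝ} (hρ : 0 ≤ ρ)
    (hF : ∀ s, P s → ∑ u, prob x u * F (step s u) ≤ ρ * F s) (m : ℕ) :
    ∫ ω, F (chain step s₀ (X · ω) m) ∂μ ≤ ρ ^ m * F s₀ := by
  induction m with
  | zero => simp [chain]
  | succ m ih =>
    rw [integral_comp_chain_succ hX hx]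
    calc ∫ ω, ∑ u, prob x u * F (step (chain step s₀ (X · ω) m) u) ∂μ
        ≤ ∫ ω, ρ * F (chain step s₀ (X · ω) m) ∂μ :=
          integral_mono
            (integrable_comp_chain hX step s₀ (fun s => ∑ u, prob x u * F (step s u)) m)
            ((integrable_comp_chain hX step s₀ F m).const_mul ρ)
            fun ω => hF _ (chain_invariant h₀ hP _ _)
      _ ≤ ρ * (ρ ^ m * F s₀) := by
          rw [integral_const_mul]
          exact mul_le_mul_of_nonneg_left ih hρ
      _ = ρ ^ (m + 1) * F s₀ := by ring

lemma measureReal_le_chain (hX : IsSampling μ X x) (hx : ∀ u, 0 ≤ x u)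
    {step : σ → V → σ} {s₀ : σ} {P : σ → Prop} (h₀ : P s₀) (hP : ∀ s u, P s → P (step s u))
    {F : σ → ℝ} (hF₀ : ∀ s, 0 ≤ F s) {ρ : ℝ} (hρ : 0 ≤ ρ)
    (hF : ∀ s, P s → ∑ u, prob x u * F (step s u) ≤ ρ * F s) (m : ℕ) {a : ℝ} (ha : 0 < a) :
    μ.real {ω | a ≤ F (chain step s₀ (X · ω) m)} ≤ ρ ^ m * F s₀ / a := by
  rw [le_div_iff₀' ha]
  exact (mul_meas_ge_le_integral_of_nonneg (ae_of_all _ fun ω => hF₀ _)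
    (integrable_comp_chain hX step s₀ F m) a).trans (integral_comp_chain_le hX hx h₀ hP hρ hF m)

end Sampling

/-! ### The algorithm as a chain, its stopped version and halting -/

section Algorithm

variable {V : Type*} [DecidableEq V] {x : V → ℝ}

/-- The loop body, run on the sample `(u, x u)`. -/
noncomputable def drawStep (x : V → ℝ) (s : State V) (u : V) : State V := s.body (u, x u)

/-- The loop body, run on the sample `(u, x u)` as long as the number of repeats is below `k`. -/
noncomputable def stoppedStep (k : ℕ) (x : V → ℝ) (s : State V) (u : V) : State V :=
  if s.r < k then drawStep x s u else s

lemma stateAfter_eq_chain (y : ℕ → V) (m : ℕ) :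
    stateAfter (fun i => (y i, x (y i))) m = chain (drawStep x) State.init y m := by
  induction m with
  | zero => rfl
  | succ m ih => simp [stateAfter, chain, ih, drawStep]

lemma drawStep_of_mem {s : State V} {u : V} (h : u ∈ s.S) :
    drawStep x s u = ⟨s.S, s.wS, s.w + s.wS, s.r + 1⟩ := if_pos h

lemma drawStep_of_notMem {s : State V} {u : V} (h : u ∉ s.S) :
    drawStep x s u = ⟨insert u s.S, s.wS + x u, s.w + s.wS, s.r⟩ := if_neg h

lemma wS_drawStep {s : State V} (h : s.wS = ∑ u ∈ s.S, x u) (u : V) :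
    (drawStep x s u).wS = ∑ v ∈ (drawStep x s u).S, x v := by
  by_cases hu : u ∈ s.S
  · simpa [drawStep_of_mem hu] using h
  · simp [drawStep_of_notMem hu, Finset.sum_insert hu, h, add_comm]

lemma r_drawStep_le (s : State V) (u : V) : (drawStep x s u).r ≤ s.r + 1 := by
  by_cases hu : u ∈ s.S
  · simp [drawStep_of_mem hu]
  · simp [drawStep_of_notMem hu]

/-- Each sample is either a repeat or a new element of `S`. As `|S| ≤ |V|`, this forces halting on
every stream. -/
lemma r_add_card_chain (y : ℕ → V) (m : ℕ) :
    (chain (drawStep x) State.init y m).r + (chain (drawStep x) State.init y m).S.card = m := by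
  induction m with
  | zero => rfl
  | succ m ih =>
    by_cases hu : y m ∈ (chain (drawStep x) State.init y m).S
    · simp only [chain, drawStep_of_mem hu]
      omega
    · simp only [chain, drawStep_of_notMem hu, Finset.card_insert_of_notMem hu]
      omega

lemma chain_stoppedStep_of_le {k : ℕ} (y : ℕ → V) {m : ℕ}
    (hm : ∀ i < m, (chain (drawStep x) State.init y i).r < k) {i : ℕ} (hi : i ≤ m) :
    chain (stoppedStep k x) State.init y i = chain (drawStep x) State.init y i := by
  induction i with
  | zero => rfl
  | succ i ih =>
    simp only [chain, ih (by omega)]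
    exact if_pos (hm i (by omega))

lemma chain_stoppedStep_of_ge {k : ℕ} (y : ℕ → V) {m : ℕ}
    (hm : ∀ i < m, (chain (drawStep x) State.init y i).r < k)
    (hk : k ≤ (chain (drawStep x) State.init y m).r) {i : ℕ} (hi : m ≤ i) :
    chain (stoppedStep k x) State.init y i = chain (drawStep x) State.init y m := by
  induction i, hi using Nat.le_induction with
  | base => exact chain_stoppedStep_of_le y hm le_rfl
  | succ i _ ih =>
    simp only [chain, ih]
    exact if_neg (by omega)

/-- The number of repeats of the stopped algorithm never exceeds the threshold. -/
lemma r_stoppedStep_le {k : ℕ} {s : State V} (hs : s.r ≤ k) (u : V) :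
    (stoppedStep k x s u).r ≤ k := by
  unfold stoppedStep
  split_ifs with h
  · exact (r_drawStep_le s u).trans h
  · exact hs

/-- If the number of repeats reaches `k` within `N` samples, then it does so for the first time
after some `m ≤ N` samples. -/
lemma exists_first_le {k N : ℕ} (y : ℕ → V) (hN : k ≤ (chain (drawStep x) State.init y N).r) :
    ∃ m ≤ N, (∀ i < m, (chain (drawStep x) State.init y i).r < k) ∧
      k ≤ (chain (drawStep x) State.init y m).r := by
  classical
  have hex : ∃ m, k ≤ (chain (drawStep x) State.init y m).r := ⟨N, hN⟩
  exact ⟨Nat.find hex, Nat.find_min' hex hN, fun i hi => not_le.1 (Nat.find_min hex hi),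
    Nat.find_spec hex⟩

/-- The algorithm halts on every stream, after at most `k + |V|` samples. -/
lemma le_r_chain [Fintype V] (k : ℕ) (y : ℕ → V) :
    k ≤ (chain (drawStep x) State.init y (k + Fintype.card V)).r := by
  have h := r_add_card_chain (x := x) y (k + Fintype.card V)
  have := Finset.card_le_univ (chain (drawStep x) State.init y (k + Fintype.card V)).S
  omega

/-- If the number of repeats among the first `N` samples reaches the threshold, then the
algorithm returns within `N` samples, and its estimate is read off the stopped chain. -/
lemma exists_returns [Fintype V] {ε δ : ℝ} {N : ℕ} (y : ℕ → V)
    (hN : threshold ε δ ≤ (chain (drawStep x) State.init y N).r) :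
    ∃ m ≤ N, Returns ε δ (fun i => (y i, x (y i)))
      ((chain (stoppedStep (threshold ε δ) x) State.init y
        (threshold ε δ + Fintype.card V)).w / threshold ε δ) m ∧
      (chain (stoppedStep (threshold ε δ) x) State.init y
        (threshold ε δ + Fintype.card V)).r = threshold ε δ := by
  obtain ⟨m, hmN, hlt, hge⟩ := exists_first_le y hN
  -- Halting by time `k + |V|` is certain, so the stopped chain at that fixed time holds the final
  -- values whatever `N` is.
  have hm : m ≤ threshold ε δ + Fintype.card V := by
    by_contra! h
    exact (hlt _ h).not_ge (le_r_chain _ _)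
  have heq := chain_stoppedStep_of_ge y hlt hge hm
  have hr : (chain (stoppedStep (threshold ε δ) x) State.init y
      (threshold ε δ + Fintype.card V)).r ≤ threshold ε δ :=
    chain_invariant (P := fun s : State V => s.r ≤ threshold ε δ) (Nat.zero_le _)
      (fun _ u hs => r_stoppedStep_le hs u) _ _
  have hr' : (chain (drawStep x) State.init y m).r = threshold ε δ :=
    le_antisymm (heq ▸ hr) hge
  refine ⟨m, hmN, ⟨fun i hi => ?_, ?_, ?_⟩, by rw [heq, hr']⟩
  · rw [stateAfter_eq_chain]
    exact hlt i hi
  · rw [stateAfter_eq_chain]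
    exact hge
  · rw [stateAfter_eq_chain, heq, hr']

end Algorithm

/-! ### One-step drift of the two exponential potentials -/

section Drift

/-- `exp (-t) ≤ 1 / (1 + t)`, and `(1 + t) (1 - t / 2) ≥ 1` on `[0, 1]`. -/
lemma exp_neg_le_one_sub_half {t : ℝ} (h₀ : 0 ≤ t) (h₁ : t ≤ 1) :
    Real.exp (-t) ≤ 1 - t / 2 := by
  have h : Real.exp (-t) * (t + 1) ≤ 1 := by
    calc Real.exp (-t) * (t + 1) ≤ Real.exp (-t) * Real.exp t :=
          mul_le_mul_of_nonneg_left (Real.add_one_le_exp t) (Real.exp_pos _).le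
      _ = 1 := by rw [← Real.exp_add, neg_add_cancel, Real.exp_zero]
  nlinarith [Real.exp_pos (-t)]

lemma norm_prob_sq {V : Type*} [Fintype V] (x : V → ℝ) : ‖prob x‖ ^ 2 = ∑ u, prob x u ^ 2 := by
  simp [EuclideanSpace.norm_sq_eq]

/-- The probability that the next sample is a repeat. -/
lemma sum_prob_eq_div {V : Type*} [Fintype V] {x : V → ℝ} {s : State V}
    (hs : s.wS = ∑ u ∈ s.S, x u) : ∑ u ∈ s.S, prob x u = s.wS / ∑ v, x v := by
  rw [hs, Finset.sum_div]
  rfl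

variable {V : Type*} [DecidableEq V] [Fintype V] {x : V → ℝ}

lemma sum_prob_mul_ite (hγ : 0 < ∑ u, x u) {s : State V} (hs : s.wS = ∑ u ∈ s.S, x u) (a : ℝ) :
    ∑ u, prob x u * (if u ∈ s.S then a else 1) =
      1 - (1 - a) * (s.wS / ∑ v, x v) := by
  have h : ∀ u, prob x u * (if u ∈ s.S then a else 1) =
      prob x u - (1 - a) * (if u ∈ s.S then prob x u else 0) := fun u => by split_ifs <;> ring
  simp only [h, Finset.sum_sub_distrib, ← Finset.mul_sum, sum_prob hγ, Finset.sum_ite_mem,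
    Finset.univ_inter, sum_prob_eq_div hs]

/-- The exponential potential that compares the cumulative weight with the number of repeats. -/
noncomputable def weightPotential (x : V → ℝ) (a : ℝ) (s : State V) : ℝ :=
  Real.exp ((1 - a) * (s.w / ∑ v, x v) + Real.log a * s.r)

lemma sum_prob_mul_weightPotential_le (hγ : 0 < ∑ u, x u) {a : ℝ} (ha : 0 < a) (k : ℕ)
    {s : State V} (hs : s.wS = ∑ u ∈ s.S, x u) :
    ∑ u, prob x u * weightPotential x a (stoppedStep k x s u) ≤ 1 * weightPotential x a s := by
  unfold stoppedStep
  split_ifs with hr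
  · have hstep : ∀ u, weightPotential x a (drawStep x s u) =
        weightPotential x a s * Real.exp ((1 - a) * (s.wS / ∑ v, x v)) *
          (if u ∈ s.S then a else 1) := by
      intro u
      by_cases hu : u ∈ s.S
      · rw [drawStep_of_mem hu, if_pos hu]
        conv_rhs => arg 2; rw [← Real.exp_log ha]
        simp only [weightPotential, ← Real.exp_add]
        push_cast
        ring_nf
      · rw [drawStep_of_notMem hu, if_neg hu]
        simp only [weightPotential, mul_one, ← Real.exp_add]
        ring_nf
    have hsum : ∑ u, prob x u * weightPotential x a (drawStep x s u) =
        weightPotential x a s * (Real.exp ((1 - a) * (s.wS / ∑ v, x v)) *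
          (1 - (1 - a) * (s.wS / ∑ v, x v))) := by
      rw [← sum_prob_mul_ite hγ hs, Finset.mul_sum, Finset.mul_sum]
      exact Finset.sum_congr rfl fun u _ => by rw [hstep]; ring
    rw [hsum, one_mul]
    refine mul_le_of_le_one_right (Real.exp_pos _).le ?_
    calc Real.exp ((1 - a) * (s.wS / ∑ v, x v)) * (1 - (1 - a) * (s.wS / ∑ v, x v))
        ≤ Real.exp ((1 - a) * (s.wS / ∑ v, x v)) * Real.exp (-((1 - a) * (s.wS / ∑ v, x v))) :=
          mul_le_mul_of_nonneg_left (Real.one_sub_le_exp_neg _) (Real.exp_pos _).le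
      _ = 1 := by rw [← Real.exp_add, add_neg_cancel, Real.exp_zero]
  · rw [← Finset.sum_mul, sum_prob hγ]

/-- The exponential potential that measures the progress towards `r` repeats: besides the
repeats, it counts the probability of a repeat in units of `q`, up to `2`. -/
noncomputable def repeatPotential (x : V → ℝ) (q : ℝ) (s : State V) : ℝ :=
  Real.exp (-(s.r + min 2 (s.wS / (∑ v, x v) / q)))

/-- A step is likely to be a repeat, or to increase the probability of a repeat. -/
lemma le_sum_prob_mul_gain (hx : ∀ u, 0 ≤ x u) {q : ℝ} (hq : 0 < q)
    (hq' : 2 * q ^ 2 ≤ ‖prob x‖ ^ 2) {s : State V} (hs : ∑ u ∈ s.S, prob x u < q) :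
    q ≤ ∑ u, prob x u * (if u ∈ s.S then 0 else min 1 (prob x u / q)) := by
  have hnn : ∀ u, 0 ≤ prob x u * (if u ∈ s.S then 0 else min 1 (prob x u / q)) := fun u => by
    have := prob_nonneg hx u
    split_ifs <;> positivity
  have hle : ∀ u ∈ s.S, prob x u ≤ ∑ v ∈ s.S, prob x v := fun u hu =>
    Finset.single_le_sum (f := fun u => prob x u) (fun v _ => prob_nonneg hx v) hu
  -- An element of mass at least `q` is outside `S`, whose mass is below `q`, and alone contributes
  -- `q`. If there is none, no cap is active and the sum is `(‖π‖² - ∑_S π²) / q ≥ (2 q² - q²) / q`.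
  by_cases hbig : ∃ u, q ≤ prob x u
  · obtain ⟨u, hu⟩ := hbig
    have hmem : u ∉ s.S := fun hmem => by linarith [hle u hmem]
    calc q ≤ prob x u * (if u ∈ s.S then 0 else min 1 (prob x u / q)) := by
          rw [if_neg hmem, min_eq_left ((one_le_div hq).2 hu), mul_one]
          exact hu
      _ ≤ _ := Finset.single_le_sum
          (f := fun u => prob x u * (if u ∈ s.S then 0 else min 1 (prob x u / q)))
          (fun v _ => hnn v) (Finset.mem_univ u)
  · push Not at hbig
    have hterm : ∀ u, prob x u * (if u ∈ s.S then 0 else min 1 (prob x u / q)) =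
        (prob x u ^ 2 - if u ∈ s.S then prob x u ^ 2 else 0) / q := fun u => by
      split_ifs
      · simp
      · rw [min_eq_right ((div_le_one hq).2 (hbig u).le)]
        ring
    simp only [hterm]
    rw [← Finset.sum_div, Finset.sum_sub_distrib, ← norm_prob_sq, Finset.sum_ite_mem,
      Finset.univ_inter, le_div_iff₀ hq]
    have : ∑ u ∈ s.S, prob x u ^ 2 ≤ q * q := calc
      ∑ u ∈ s.S, prob x u ^ 2 ≤ ∑ u ∈ s.S, q * prob x u := Finset.sum_le_sum fun u _ => by
          nlinarith [prob_nonneg hx u, hbig u]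
      _ ≤ q * q := by
          rw [← Finset.mul_sum]
          exact mul_le_mul_of_nonneg_left hs.le hq.le
    nlinarith

lemma sum_prob_mul_repeatPotential_le (hx : ∀ u, 0 ≤ x u) (hγ : 0 < ∑ u, x u) {q : ℝ}
    (hq : 0 < q) (hq' : 2 * q ^ 2 ≤ ‖prob x‖ ^ 2) {s : State V} (hs : s.wS = ∑ u ∈ s.S, x u) :
    ∑ u, prob x u * repeatPotential x q (drawStep x s u) ≤
      Real.exp (-(q / 2)) * repeatPotential x q s := by
  set p := s.wS / ∑ v, x v with hp
  have hpsum := sum_prob_eq_div hs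
  rw [← hp] at hpsum
  have hprob : ∀ u, x u / ∑ v, x v = prob x u := fun u => rfl
  have hmem : ∀ u ∈ s.S, repeatPotential x q (drawStep x s u) =
      repeatPotential x q s * Real.exp (-1) := fun u hu => by
    rw [drawStep_of_mem hu]
    simp only [repeatPotential, ← Real.exp_add]
    push_cast
    ring_nf
  -- a factor `1 - g u / 2` is gained at each sample `u`, and `g` has mean at least `q`
  obtain ⟨g, hg₀, hg⟩ : ∃ g : V → ℝ, (∀ u, repeatPotential x q (drawStep x s u) ≤
      repeatPotential x q s * (1 - g u / 2)) ∧ q ≤ ∑ u, prob x u * g u := by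
    have hexp : Real.exp (-1) ≤ 1 - 1 / 2 := exp_neg_le_one_sub_half zero_le_one le_rfl
    have hpot : 0 ≤ repeatPotential x q s := (Real.exp_pos _).le
    rcases lt_or_ge p q with hpq | hpq
    · refine ⟨fun u => if u ∈ s.S then 0 else min 1 (prob x u / q), fun u => ?_,
        le_sum_prob_mul_gain hx hq hq' (hpsum ▸ hpq)⟩
      beta_reduce
      by_cases hu : u ∈ s.S
      · rw [hmem u hu, if_pos hu]
        exact mul_le_mul_of_nonneg_left (by linarith) hpot
      · rw [if_neg hu]
        have ht : 0 ≤ min 1 (prob x u / q) :=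
          le_min zero_le_one (div_nonneg (prob_nonneg hx u) hq.le)
        refine le_trans ?_ (mul_le_mul_of_nonneg_left
          (exp_neg_le_one_sub_half ht (min_le_left _ _)) hpot)
        rw [drawStep_of_notMem hu, repeatPotential, repeatPotential, ← Real.exp_add,
          Real.exp_le_exp]
        simp only [add_div, hprob, ← hp]
        -- Since `p / q < 1`, a capped increment of at most 1 stays below the cap 2 of the
        -- potential.
        have h1 : p / q < 1 := (div_lt_one hq).2 hpq
        rw [min_eq_right (a := (2 : ℝ)) (b := p / q) (by linarith)]
        rcases le_total 1 (prob x u / q) with h | h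
        · rw [min_eq_left h]
          have : p / q + 1 ≤ min 2 (p / q + prob x u / q) := le_min (by linarith) (by linarith)
          linarith
        · rw [min_eq_right h, min_eq_right (by linarith)]
          linarith
    · refine ⟨fun u => if u ∈ s.S then 1 else 0, fun u => ?_, ?_⟩
      · beta_reduce
        by_cases hu : u ∈ s.S
        · rw [hmem u hu, if_pos hu]
          exact mul_le_mul_of_nonneg_left hexp hpot
        · rw [if_neg hu, drawStep_of_notMem hu, zero_div, sub_zero, mul_one]
          simp only [repeatPotential]
          have : s.wS / (∑ v, x v) / q ≤ (s.wS + x u) / (∑ v, x v) / q := by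
            have := hx u
            gcongr
            linarith
          gcongr
      · simpa [Finset.sum_ite_mem, hpsum] using hpq
  calc ∑ u, prob x u * repeatPotential x q (drawStep x s u)
      ≤ ∑ u, prob x u * (repeatPotential x q s * (1 - g u / 2)) :=
        Finset.sum_le_sum fun u _ => mul_le_mul_of_nonneg_left (hg₀ u) (prob_nonneg hx u)
    _ = (1 - (∑ u, prob x u * g u) / 2) * repeatPotential x q s := by
        rw [← sum_prob hγ, Finset.sum_div, ← Finset.sum_sub_distrib, Finset.sum_mul]
        exact Finset.sum_congr rfl fun u _ => by ring
    _ ≤ Real.exp (-(q / 2)) * repeatPotential x q s := by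
        refine mul_le_mul_of_nonneg_right ?_ (Real.exp_pos _).le
        linarith [Real.one_sub_le_exp_neg (q / 2)]

end Drift

/-! ### Numerical estimates for the threshold and the sample bound -/

section Numerics

variable {ε δ : ℝ}

lemma one_le_log_three_div (hδ : 0 < δ) (hδ' : δ < 1) : 1 ≤ Real.log (3 / δ) := by
  rw [Real.le_log_iff_exp_le (by positivity), le_div_iff₀ hδ]
  nlinarith [Real.exp_one_lt_d9]

lemma le_threshold (ε δ : ℝ) :
    (2 + 4.4 * ε) / ε ^ 2 * Real.log (3 / δ) ≤ threshold ε δ := Nat.le_ceil _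

lemma threshold_pos (hε : 0 < ε) (hδ : 0 < δ) (hδ' : δ < 1) : 0 < threshold ε δ := by
  have := one_le_log_three_div hδ hδ'
  exact Nat.ceil_pos.2 (by positivity)

lemma threshold_le (hε : 0 < ε) (hε' : ε < 1) (hδ : 0 < δ) (hδ' : δ < 1) :
    (threshold ε δ : ℝ) ≤ 6.4 * ((ε ^ 2)⁻¹ * Real.log (3 / δ)) + 1 := by
  have hL := one_le_log_three_div hδ hδ'
  refine (Nat.ceil_lt_add_one (by positivity)).le.trans (add_le_add_left ?_ 1)
  rw [div_eq_mul_inv, mul_assoc]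
  exact mul_le_mul_of_nonneg_right (by linarith) (by positivity)

/-- Here `c` is the exponent gained per repeat, `b - 1 - log b` with `b = 1 ± ε`. -/
lemma le_mul_threshold (hε : 0 < ε) (hδ : 0 < δ) (hδ' : δ < 1) {c : ℝ}
    (hc : ε ^ 2 ≤ c * (2 + 4.4 * ε)) : Real.log (3 / δ) ≤ c * threshold ε δ := by
  have hL := one_le_log_three_div hδ hδ'
  have hc0 : 0 < c := by
    by_contra! h
    nlinarith [mul_nonneg (neg_nonneg.2 h) (by linarith : 0 ≤ 2 + 4.4 * ε), pow_pos hε 2]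
  calc Real.log (3 / δ) = 1 * Real.log (3 / δ) := (one_mul _).symm
    _ ≤ c * (2 + 4.4 * ε) / ε ^ 2 * Real.log (3 / δ) := by
        refine mul_le_mul_of_nonneg_right ?_ (by linarith)
        rwa [one_le_div (by positivity)]
    _ = c * ((2 + 4.4 * ε) / ε ^ 2 * Real.log (3 / δ)) := by ring
    _ ≤ c * threshold ε δ := mul_le_mul_of_nonneg_left (le_threshold ε δ) hc0.le

/-- This is `t ≤ sinh t` at `t = log (1 + ε)`. -/
lemma log_one_add_le (hε : 0 < ε) : Real.log (1 + ε) ≤ ε - ε ^ 2 / (2 * (1 + ε)) := by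
  have h := Real.self_le_sinh_iff.2 (Real.log_nonneg (by linarith : 1 ≤ 1 + ε))
  rw [Real.sinh_log (by linarith)] at h
  refine h.trans (le_of_eq ?_)
  field_simp
  ring

/-- Truncation of the series of `-log (1 - ε)`, whose terms are nonnegative. -/
lemma log_one_sub_le (hε : 0 < ε) (hε' : ε < 1) : Real.log (1 - ε) ≤ -ε - ε ^ 2 / 2 := by
  have h := sum_le_hasSum (Finset.range 2) (fun n _ => by positivity)
    (Real.hasSum_pow_div_log_of_abs_lt_one (by rwa [abs_of_pos hε] : |ε| < 1))
  norm_num [Finset.sum_range_succ] at h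
  linarith

lemma log_le_upper_exponent (hε : 0 < ε) (hδ : 0 < δ) (hδ' : δ < 1) :
    Real.log (3 / δ) ≤ (1 + ε - 1 - Real.log (1 + ε)) * threshold ε δ := by
  refine le_mul_threshold hε hδ hδ' ?_
  calc ε ^ 2 = ε ^ 2 / (2 * (1 + ε)) * (2 + 2 * ε) := by field_simp
    _ ≤ (1 + ε - 1 - Real.log (1 + ε)) * (2 + 4.4 * ε) := by
        have h := log_one_add_le hε
        have h0 : 0 ≤ ε ^ 2 / (2 * (1 + ε)) := by positivity
        exact mul_le_mul (by linarith) (by linarith) (by positivity) (by linarith)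

lemma log_le_lower_exponent (hε : 0 < ε) (hε' : ε < 1) (hδ : 0 < δ) (hδ' : δ < 1) :
    Real.log (3 / δ) ≤ (1 - ε - 1 - Real.log (1 - ε)) * threshold ε δ := by
  refine le_mul_threshold hε hδ hδ' ?_
  have h := log_one_sub_le hε hε'
  nlinarith [pow_pos hε 2, pow_pos hε 3]

lemma norm_prob_pos {V : Type*} [Fintype V] {x : V → ℝ} (hγ : 0 < ∑ u, x u) :
    0 < ‖prob x‖ := by
  refine norm_pos_iff.2 fun h => ?_
  have := sum_prob hγ
  simp [h] at this

lemma norm_prob_le_one {V : Type*} [Fintype V] {x : V → ℝ} (hx : ∀ u, 0 ≤ x u)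
    (hγ : 0 < ∑ u, x u) : ‖prob x‖ ≤ 1 := by
  refine (sq_le_one_iff₀ (norm_nonneg _)).1 ?_
  rw [norm_prob_sq, ← sum_prob hγ]
  refine Finset.sum_le_sum fun u _ => ?_
  have h1 : prob x u ≤ 1 := by
    rw [← sum_prob hγ]
    exact Finset.single_le_sum (f := fun u => prob x u) (fun v _ => prob_nonneg hx v)
      (Finset.mem_univ u)
  nlinarith [prob_nonneg hx u]

lemma threshold_add_le_norm_mul_sampleBound {V : Type*} [Fintype V] {x : V → ℝ}
    (hγ : 0 < ∑ u, x u) (hε : 0 < ε) (hε' : ε < 1) (hδ : 0 < δ) (hδ' : δ < 1) :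
    threshold ε δ + 1 + Real.log (3 / δ) ≤ ‖prob x‖ / 4 * sampleBound x ε δ := by
  have hL := one_le_log_three_div hδ hδ'
  have hn := norm_prob_pos hγ
  have hk := threshold_le hε hε' hδ hδ'
  set L := Real.log (3 / δ)
  have hε2 : 1 ≤ (ε ^ 2)⁻¹ := (one_le_inv₀ (by positivity)).2 (pow_le_one₀ hε.le hε'.le)
  have hLL : L ≤ (ε ^ 2)⁻¹ * L := le_mul_of_one_le_left (by linarith) hε2
  have hpow : (ε ^ 2)⁻¹ * L ≤ (ε ^ 3)⁻¹ * L ^ (3 / 2 : ℝ) := by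
    refine mul_le_mul ?_ ?_ (by linarith) (by positivity)
    · exact inv_anti₀ (by positivity) (pow_le_pow_of_le_one hε.le hε'.le (by norm_num))
    · exact Real.self_le_rpow_of_one_le hL (by norm_num)
  -- The left side is at most `6.4 ε⁻² L + 2 + L ≤ 9.4 ε⁻² L`, as `ε⁻² L ≥ L ≥ 1`.
  calc threshold ε δ + 1 + L ≤ 45 / 4 * ((ε ^ 3)⁻¹ * L ^ (3 / 2 : ℝ)) := by linarith
    _ = ‖prob x‖ / 4 * (45 * ‖prob x‖⁻¹ * (ε ^ 3)⁻¹ * L ^ (3 / 2 : ℝ)) := by field_simp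
    _ ≤ ‖prob x‖ / 4 * sampleBound x ε δ :=
        mul_le_mul_of_nonneg_left (Nat.le_ceil _) (by positivity)

lemma sampleBound_le {V : Type*} [Fintype V] {x : V → ℝ} (hx : ∀ u, 0 ≤ x u)
    (hγ : 0 < ∑ u, x u) (hε : 0 < ε) (hε' : ε < 1) (hδ : 0 < δ) (hδ' : δ < 1) {δ₀ : ℝ}
    (hδ₀ : δ ≤ δ₀) (hδ₀' : δ₀ < 1) :
    (sampleBound x ε δ : ℝ) ≤ 46 * (Real.log 3 / Real.log (1 / δ₀) + 1) ^ (3 / 2 : ℝ) *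
      ‖prob x‖⁻¹ * (ε ^ 3)⁻¹ * Real.log (1 / δ) ^ (3 / 2 : ℝ) := by
  have hL := one_le_log_three_div hδ hδ'
  have hn := norm_prob_pos hγ
  have h0 : 0 < δ₀ := hδ.trans_le hδ₀
  have hl₀ : 0 < Real.log (1 / δ₀) := Real.log_pos ((one_lt_div h0).2 hδ₀')
  have hl : Real.log (1 / δ₀) ≤ Real.log (1 / δ) :=
    Real.log_le_log (by positivity) (one_div_le_one_div_of_le hδ hδ₀)
  have hl3 : 0 < Real.log 3 := Real.log_pos (by norm_num)
  have hbase : 1 ≤ ‖prob x‖⁻¹ * (ε ^ 3)⁻¹ * Real.log (3 / δ) ^ (3 / 2 : ℝ) :=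
    one_le_mul_of_one_le_of_one_le (one_le_mul_of_one_le_of_one_le
      ((one_le_inv₀ hn).2 (norm_prob_le_one hx hγ))
      ((one_le_inv₀ (by positivity)).2 (pow_le_one₀ hε.le hε'.le)))
      (Real.one_le_rpow hL (by norm_num))
  have hlog : Real.log (3 / δ) ≤ (Real.log 3 / Real.log (1 / δ₀) + 1) * Real.log (1 / δ) := by
    have h1 : Real.log (3 / δ) = Real.log 3 + Real.log (1 / δ) := by
      rw [← Real.log_mul (by norm_num) (by positivity), mul_one_div]
    have h2 : Real.log 3 ≤ Real.log 3 / Real.log (1 / δ₀) * Real.log (1 / δ) := by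
      rw [div_mul_eq_mul_div, le_div_iff₀ hl₀]
      exact mul_le_mul_of_nonneg_left hl hl3.le
    linarith
  calc (sampleBound x ε δ : ℝ)
      ≤ 45 * ‖prob x‖⁻¹ * (ε ^ 3)⁻¹ * Real.log (3 / δ) ^ (3 / 2 : ℝ) + 1 :=
        (Nat.ceil_lt_add_one (by positivity)).le
    -- The 1 lost to the ceiling is absorbed by `hbase`, turning 45 into 46.
    _ ≤ 46 * ‖prob x‖⁻¹ * (ε ^ 3)⁻¹ * Real.log (3 / δ) ^ (3 / 2 : ℝ) := by linarith
    _ ≤ 46 * ‖prob x‖⁻¹ * (ε ^ 3)⁻¹ *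
          ((Real.log 3 / Real.log (1 / δ₀) + 1) * Real.log (1 / δ)) ^ (3 / 2 : ℝ) := by
        gcongr
    _ = _ := by
        rw [Real.mul_rpow (by positivity) (by linarith)]
        ring

end Numerics

/-- Serves both tails: `1 - b⁻¹` is negative for `0 < b < 1`, so `hw` then bounds `w` from above. -/
lemma le_weightPotential {V : Type*} [Fintype V] {x : V → ℝ} {δ : ℝ} (hδ : 0 < δ) {b : ℝ}
    {s : State V}
    (hb : Real.log (3 / δ) ≤ (b - 1 - Real.log b) * s.r)
    (hw : (b - 1) * s.r ≤ (1 - b⁻¹) * (s.w / ∑ v, x v)) :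
    3 / δ ≤ weightPotential x b⁻¹ s := by
  rw [weightPotential, ← Real.log_le_iff_le_exp (by positivity), Real.log_inv]
  linarith

/-- Outside the two tail events of the weight potential, the estimate is accurate. -/
lemma abs_estimate_sub_lt {V : Type*} [Fintype V] {x : V → ℝ} {ε δ : ℝ}
    (hγ : 0 < ∑ u, x u) (hε : 0 < ε) (hε' : ε < 1) (hδ : 0 < δ) (hδ' : δ < 1)
    {s : State V} (hr : s.r = threshold ε δ)
    (hup : ¬ 3 / δ ≤ weightPotential x (1 + ε)⁻¹ s)
    (hlow : ¬ 3 / δ ≤ weightPotential x (1 - ε)⁻¹ s) :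
    |s.w / threshold ε δ - ∑ u, x u| < ε * ∑ u, x u := by
  have hk : (0 : ℝ) < threshold ε δ := Nat.cast_pos.2 (threshold_pos hε hδ hδ')
  have hwk : s.w / threshold ε δ = s.w / (∑ u, x u) / threshold ε δ * ∑ u, x u := by
    field_simp
  have hup' : s.w / (∑ u, x u) / threshold ε δ < 1 + ε := by
    rw [div_lt_iff₀ hk]
    by_contra! h
    refine hup (le_weightPotential hδ (hr ▸ log_le_upper_exponent hε hδ hδ') ?_)
    rw [hr]
    have h1 : 1 - (1 + ε)⁻¹ = ε * (1 + ε)⁻¹ := by field_simp; ring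
    calc (1 + ε - 1) * threshold ε δ
        = ε * (1 + ε)⁻¹ * ((1 + ε) * threshold ε δ) := by field_simp; ring
      _ ≤ (1 - (1 + ε)⁻¹) * (s.w / ∑ v, x v) := by
          rw [h1]
          exact mul_le_mul_of_nonneg_left h (by positivity)
  have hlow' : 1 - ε < s.w / (∑ u, x u) / threshold ε δ := by
    rw [lt_div_iff₀ hk]
    by_contra! h
    refine hlow (le_weightPotential hδ (hr ▸ log_le_lower_exponent hε hε' hδ hδ') ?_)
    rw [hr]
    have hpos : 0 < 1 - ε := by linarith
    have h1 : 1 - (1 - ε)⁻¹ = -(ε * (1 - ε)⁻¹) := by field_simp; ring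
    have h2 : ε * (1 - ε)⁻¹ * (s.w / ∑ v, x v) ≤
        ε * (1 - ε)⁻¹ * ((1 - ε) * threshold ε δ) :=
      mul_le_mul_of_nonneg_left h (by positivity)
    have h3 : ε * (1 - ε)⁻¹ * ((1 - ε) * threshold ε δ) = ε * threshold ε δ := by field_simp
    rw [h1]
    linarith
  rw [hwk, abs_lt]
  constructor <;> nlinarith

/-! ### Probabilities of the bad events -/

section Tails

variable {V : Type*} [Fintype V] [DecidableEq V] [MeasurableSpace V] [DiscreteMeasurableSpace V]
  {Ω : Type*} [MeasurableSpace Ω] {μ : Measure Ω} [IsProbabilityMeasure μ]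
  {X : ℕ → Ω → V} {x : V → ℝ} {ε δ : ℝ}

lemma measureReal_weightPotential_le (hX : IsSampling μ X x) (hx : ∀ u, 0 ≤ x u)
    (hγ : 0 < ∑ u, x u) (hδ : 0 < δ) {a : ℝ} (ha : 0 < a) (k m : ℕ) :
    μ.real {ω | 3 / δ ≤ weightPotential x a
      (chain (stoppedStep k x) State.init (X · ω) m)} ≤ δ / 3 := by
  refine (measureReal_le_chain (F := weightPotential x a) (ρ := 1) hX hx
    (P := fun s : State V => s.wS = ∑ u ∈ s.S, x u)
    (by simp [State.init]) (fun s u hs => ?_) (fun s => (Real.exp_pos _).le) zero_le_one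
    (fun s hs => sum_prob_mul_weightPotential_le hγ ha k hs) m (by positivity)).trans ?_
  · unfold stoppedStep
    split_ifs
    · exact wS_drawStep hs u
    · exact hs
  · simp [weightPotential, State.init]

/-- The probability that fewer repeats than required occur among the first `sampleBound`
samples. -/
lemma measureReal_r_lt_threshold_le (hX : IsSampling μ X x) (hx : ∀ u, 0 ≤ x u)
    (hγ : 0 < ∑ u, x u) (hε : 0 < ε) (hε' : ε < 1) (hδ : 0 < δ) (hδ' : δ < 1) :
    μ.real {ω | (chain (drawStep x) State.init (X · ω) (sampleBound x ε δ)).r < threshold ε δ} ≤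
      δ / 3 := by
  have hn := norm_prob_pos hγ
  set N := sampleBound x ε δ
  set k := threshold ε δ
  have hmain := measureReal_le_chain (F := repeatPotential x (‖prob x‖ / 2))
    (ρ := Real.exp (-(‖prob x‖ / 2 / 2))) hX hx
    (P := fun s : State V => s.wS = ∑ u ∈ s.S, x u) (s₀ := State.init)
    (by simp [State.init]) (fun s u hs => wS_drawStep hs u) (fun s => (Real.exp_pos _).le)
    (Real.exp_pos _).le
    (fun s hs => sum_prob_mul_repeatPotential_le hx hγ (by positivity) (by nlinarith) hs) N
    -- Too few repeats means `r ≤ k - 1`; with the cap 2 the exponent is at least `-(k + 1)`.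
    (Real.exp_pos (-(k + 1)))
  have hinit : repeatPotential x (‖prob x‖ / 2) (State.init : State V) = 1 := by
    simp [repeatPotential, State.init]
  refine (measureReal_mono fun ω hω => ?_).trans (hmain.trans ?_)
  · have hr : ((chain (drawStep x) State.init (X · ω) N).r : ℝ) + 1 ≤ k := by
      exact_mod_cast hω
    refine Real.exp_le_exp.2 (neg_le_neg ?_)
    linarith [min_le_left 2
      ((chain (drawStep x) State.init (X · ω) N).wS / (∑ v, x v) / (‖prob x‖ / 2))]
  · rw [hinit, mul_one, ← Real.exp_nat_mul, ← Real.exp_sub]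
    have hδ3 : δ / 3 = Real.exp (-Real.log (3 / δ)) := by
      rw [Real.exp_neg, Real.exp_log (by positivity), inv_div]
    rw [hδ3, Real.exp_le_exp]
    have : (k : ℝ) + 1 + Real.log (3 / δ) ≤ ‖prob x‖ / 4 * N :=
      threshold_add_le_norm_mul_sampleBound hγ hε hε' hδ hδ'
    linarith

end Tails

/-- Subadditivity on `s ∪ t` avoids having to prove that the events are measurable. -/
lemma one_sub_le_measureReal {Ω : Type*} [MeasurableSpace Ω] {μ : Measure Ω}
    [IsProbabilityMeasure μ] {s t : Set Ω} (h : ∀ ω, ω ∉ t → ω ∈ s) {c : ℝ} (ht : μ.real t ≤ c) :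
    1 - c ≤ μ.real s := by
  have h1 : μ.real (s ∪ t) = 1 := by
    rw [Set.eq_univ_of_forall (s := s ∪ t) fun ω => or_iff_not_imp_right.2 (h ω), probReal_univ]
  linarith [measureReal_union_le (μ := μ) s t]

end SumApprox

theorem theorem1 (δ₀ : ℝ) (hδ₀ : 0 < δ₀) (hδ₀' : δ₀ < 1) :
    ∃ C : ℝ, 0 < C ∧
      ∀ (V : Type*) [Fintype V] [DecidableEq V] [MeasurableSpace V] [DiscreteMeasurableSpace V]
        (x : V → ℝ) (_ : ∀ u, 0 ≤ x u) (γ : ℝ) (_ : γ = ∑ u, x u) (_ : 0 < γ)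
        (Ω : Type*) [MeasurableSpace Ω] (μ : Measure Ω) [IsProbabilityMeasure μ]
        (X : ℕ → Ω → V) (_ : SumApprox.IsSampling μ X x)
        (ε δ : ℝ) (_ : 0 < ε) (_ : ε < 1) (_ : 0 < δ) (_ : δ < 1),
        -- correctness
        1 - 2 * δ / 3 ≤ μ.real {ω | ∃ est m,
          SumApprox.Returns ε δ (fun i => (X i ω, x (X i ω))) est m ∧ |est - γ| < ε * γ} ∧
        -- number of samples
        1 - δ / 3 ≤ μ.real {ω | ∃ est m,
          SumApprox.Returns ε δ (fun i => (X i ω, x (X i ω))) est m ∧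
          m ≤ SumApprox.sampleBound x ε δ} ∧
        -- both together, with the explicit bound on the number of samples
        1 - δ ≤ μ.real {ω | ∃ est m,
          SumApprox.Returns ε δ (fun i => (X i ω, x (X i ω))) est m ∧
          (1 - ε) * γ ≤ est ∧ est ≤ (1 + ε) * γ ∧
          m ≤ SumApprox.sampleBound x ε δ} ∧
        -- both together, with the asymptotic bound on the number of samples
        (δ ≤ δ₀ → 1 - δ ≤ μ.real {ω | ∃ est m,
          SumApprox.Returns ε δ (fun i => (X i ω, x (X i ω))) est m ∧
          (1 - ε) * γ ≤ est ∧ est ≤ (1 + ε) * γ ∧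
          (m : ℝ) ≤ C * ‖SumApprox.prob x‖⁻¹ * (ε ^ 3)⁻¹ * Real.log (1 / δ) ^ (3 / 2 : ℝ)}) := by
  have hl₀ : 0 < Real.log (1 / δ₀) := Real.log_pos ((one_lt_div hδ₀).2 hδ₀')
  have hl3 : 0 < Real.log 3 := Real.log_pos (by norm_num)
  refine ⟨46 * (Real.log 3 / Real.log (1 / δ₀) + 1) ^ (3 / 2 : ℝ), by positivity, ?_⟩
  intro V _ _ _ _ x hx γ hγx hγ Ω _ μ _ X hX ε δ hε hε' hδ hδ'
  subst hγx
  set k := SumApprox.threshold ε δ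
  set final : Ω → SumApprox.State V := fun ω => SumApprox.chain (SumApprox.stoppedStep k x)
    SumApprox.State.init (X · ω) (k + Fintype.card V)
  set up : Set Ω := {ω | 3 / δ ≤ SumApprox.weightPotential x (1 + ε)⁻¹ (final ω)}
  set low : Set Ω := {ω | 3 / δ ≤ SumApprox.weightPotential x (1 - ε)⁻¹ (final ω)}
  set late : Set Ω := {ω | (SumApprox.chain (SumApprox.drawStep x) SumApprox.State.init (X · ω)
    (SumApprox.sampleBound x ε δ)).r < k}
  have hup : μ.real up ≤ δ / 3 :=
    SumApprox.measureReal_weightPotential_le hX hx hγ hδ (by positivity) _ _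
  have hlow : μ.real low ≤ δ / 3 :=
    SumApprox.measureReal_weightPotential_le hX hx hγ hδ (inv_pos.2 (by linarith)) _ _
  have hlate : μ.real late ≤ δ / 3 :=
    SumApprox.measureReal_r_lt_threshold_le hX hx hγ hε hε' hδ hδ'
  have hupLow : μ.real (up ∪ low) ≤ 2 * δ / 3 := by
    linarith [measureReal_union_le (μ := μ) up low]
  have hall : μ.real (up ∪ low ∪ late) ≤ δ := by
    linarith [measureReal_union_le (μ := μ) (up ∪ low) late]
  have haccurate : ∀ ω, ω ∉ up ∪ low → (final ω).r = k →
      |(final ω).w / k - ∑ u, x u| < ε * ∑ u, x u := fun ω hω hr =>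
    SumApprox.abs_estimate_sub_lt hγ hε hε' hδ hδ' hr (fun h => hω (Or.inl h))
      (fun h => hω (Or.inr h))
  have hboth : ∀ ω, ω ∉ up ∪ low ∪ late → ∃ est m,
      SumApprox.Returns ε δ (fun i => (X i ω, x (X i ω))) est m ∧
      (1 - ε) * ∑ u, x u ≤ est ∧ est ≤ (1 + ε) * ∑ u, x u ∧
      m ≤ SumApprox.sampleBound x ε δ := fun ω hω => by
    obtain ⟨m, hm, hret, hr⟩ := SumApprox.exists_returns (x := x) (X · ω)
      (not_lt.1 fun h => hω (Or.inr h))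
    have h := abs_lt.1 (haccurate ω (fun h => hω (Or.inl h)) hr)
    exact ⟨_, m, hret, by linarith [h.1], by linarith [h.2], hm⟩
  refine ⟨SumApprox.one_sub_le_measureReal (fun ω hω => ?_) hupLow,
    SumApprox.one_sub_le_measureReal (fun ω hω => ?_) hlate,
    SumApprox.one_sub_le_measureReal hboth hall,
    fun hδδ₀ => SumApprox.one_sub_le_measureReal (fun ω hω => ?_) hall⟩
  -- Correctness uses the horizon `k + |V|`, where halting is certain, so the event `late` costs
  -- nothing here.
  · obtain ⟨m, _, hret, hr⟩ := SumApprox.exists_returns (x := x) (X · ω)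
      (SumApprox.le_r_chain k (X · ω))
    exact ⟨_, m, hret, haccurate ω hω hr⟩
  · obtain ⟨m, hm, hret, _⟩ := SumApprox.exists_returns (x := x) (X · ω) (not_lt.1 hω)
    exact ⟨_, m, hret, hm⟩
  · obtain ⟨est, m, hret, h1, h2, hm⟩ := hboth ω hω
    exact ⟨est, m, hret, h1, h2, (Nat.cast_le.2 hm).trans
      (SumApprox.sampleBound_le hx hγ hε hε' hδ hδ' hδδ₀ hδ₀')⟩
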